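/- Let $k\in\mathbb Z$ and $s\in\mathbb C$ with $\operatorname{Re}(s)>\frac34-\frac k2$. All complex powers and square roots are taken with the principal branch ($-\pi<\arg\le\pi$). For odd $d\in\mathbb Z$ let $\left(\frac{c}{d}\right)$ be the extended Jacobi (Kronecker) symbol, i.e. the Jacobi symbol $\left(\frac{c}{|d|}\right)$, multiplied by $-1$ if $c$ and $d$ are both negative (so $\left(\frac{0}{\pm1}\right)=1$), and let $\varepsilon_d=\sqrt{\left(\frac{-1}{d}\right)}$, that is, $\varepsilon_d=1$ if $d\equiv1\pmod 4$ and $\varepsilon_d=i$ if $d\equiv3\pmod 4$. For $\gamma=\begin{pmatrix}a&b\\c&d\end{pmatrix}\in\Gamma_0(4)$ let $v_\vartheta(\gamma)=\left(\frac{c}{d}\right)\varepsilon_d^{-1}$ be the theta multiplier and put $j(\gamma,\tau)=c\tau+d$. For $\tau$ in the upper half-plane $\mathbb H$ define $$E_{k+1/2,s}(\tau)=\sum_{\substack{m\ge1\\ m\text{ odd}}}\ \sum_{\substack{n\in\mathbb Z\\ \gcd(n,m)=1}}\frac{\left(\frac{n}{m}\right)\varepsilon_m^{-2k-1}}{(m\tau+n)^{k+1/2}\,|m\tau+n|^{2s}},\qquad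 F_{k+1/2,s}(\tau)=\tau^{-k-1/2}|\tau|^{-2s}E_{k+1/2,s}\!\left(\frac{-1}{4\tau}\right),$$ and, for $k\ne0$, $$H_{k+1/2,s}(\tau)=\frac{\zeta(1-2k)}{2^{2k+1}}\left[(1+i^{2k+1})E_{k+1/2,s}(\tau)+i^{2k+1}F_{k+1/2,s}(\tau)\right].$$ Then the double series defining $E_{k+1/2,s}(\tau)$ converges absolutely for every $\tau\in\mathbb H$, and for all $\gamma\in\Gamma_0(4)$ and $\tau\in\mathbb H$ $$E_{k+1/2,s}(\gamma\tau)=v_\vartheta(\gamma)^{2k+1}\,j(\gamma,\tau)^{k+1/2}\,|j(\gamma,\tau)|^{2s}\,E_{k+1/2,s}(\tau).$$ The same transformation law holds with $E_{k+1/2,s}$ replaced by $F_{k+1/2,s}$ and, if $k\neq0$, by $H_{k+1/2,s}$. -/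

import Mathlib

open UpperHalfPlane
open scoped MatrixGroups

noncomputable section

namespace CohenEisenstein

/-- The extended Jacobi (Kronecker) symbol `(a/d)` for odd `d`: the usual Jacobi symbol
`(a/|d|)`, with an extra sign `-1` when `a` and `d` are both negative. In particular
`(0/d) = 1` for `d = ±1`. -/
def kronecker (a d : ℤ) : ℤ :=
  (if a < 0 ∧ d < 0 then -1 else 1) * jacobiSym a d.natAbs

/-- `ε_d`, the principal square root of the symbol of `-1` over `d`: for odd `d` it is `1` if `d ≡ 1 (mod 4)` and `i`
if `d ≡ 3 (mod 4)`. -/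
def eps (d : ℤ) : ℂ := (kronecker (-1) d : ℂ) ^ (1 / 2 : ℂ)

/-- The theta multiplier `v_ϑ(γ) = (c/d) ε_d⁻¹`, where `(c, d)` is the bottom row of `γ`. -/
def thetaMultiplier (γ : SL(2, ℤ)) : ℂ :=
  (kronecker (γ 1 0) (γ 1 1) : ℂ) * (eps (γ 1 1))⁻¹

/-- The factor `cτ + d`, where `(c, d)` is the bottom row of `γ`. -/
def autFactor (γ : SL(2, ℤ)) (τ : ℍ) : ℂ := (γ 1 0 : ℂ) * (τ : ℂ) + (γ 1 1 : ℂ)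

/-- Pairs `(m, n)` with `m ≥ 1` odd, `n` an integer and `gcd(n, m) = 1`. -/
def EIndex : Set (ℤ × ℤ) := {p | 1 ≤ p.1 ∧ Odd p.1 ∧ Int.gcd p.2 p.1 = 1}

/-- The `(m, n)` term of the series; complex powers are taken with the principal branch. -/
def ETerm (k : ℤ) (s : ℂ) (τ : ℍ) (m n : ℤ) : ℂ :=
  ((kronecker n m : ℂ) * eps m ^ (-2 * k - 1)) /
    (((m : ℂ) * (τ : ℂ) + (n : ℂ)) ^ ((k : ℂ) + 1 / 2) *
      ((‖(m : ℂ) * (τ : ℂ) + (n : ℂ)‖ : ℝ) : ℂ) ^ (2 * s))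

/-- The Eisenstein series `E_{k+1/2,s}`. -/
def E (k : ℤ) (s : ℂ) (τ : ℍ) : ℂ := ∑' p : EIndex, ETerm k s τ p.1.1 p.1.2

/-- The point `w = -(4τ)⁻¹` of the upper half-plane. -/
def fricke (τ : ℍ) : ℍ :=
  ⟨-1 / (4 * (τ : ℂ)), by
    have h : 0 < ((-(4 * (τ : ℂ)))⁻¹).im := by
      rw [Complex.inv_im]
      have hn : 0 < Complex.normSq (-(4 * (τ : ℂ))) :=
        Complex.normSq_pos.2 (by simpa using τ.ne_zero)
      have him : 0 < -(-(4 * (τ : ℂ))).im := by simpa using τ.im_pos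
      positivity
    rwa [show (-1 : ℂ) / (4 * (τ : ℂ)) = (-(4 * (τ : ℂ)))⁻¹ by
      rw [inv_neg, neg_div, one_div]]⟩

/-- `F_{k+1/2,s}(τ) = τ^{-k-1/2} |τ|^{-2s} E_{k+1/2,s}(w)` with `w = fricke τ`, i.e. `4τw = -1`. -/
def F (k : ℤ) (s : ℂ) (τ : ℍ) : ℂ :=
  (τ : ℂ) ^ (-(k : ℂ) - 1 / 2) * ((‖(τ : ℂ)‖ : ℝ) : ℂ) ^ (-2 * s) * E k s (fricke τ)

/-- `H_{k+1/2,s} = ζ(1-2k) 2^{-2k-1} [(1 + i^{2k+1}) E_{k+1/2,s} + i^{2k+1} F_{k+1/2,s}]`,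
meaningful for `k ≠ 0`. -/
def H (k : ℤ) (s : ℂ) (τ : ℍ) : ℂ :=
  riemannZeta (1 - 2 * (k : ℂ)) / (2 : ℂ) ^ (2 * k + 1) *
    ((1 + Complex.I ^ (2 * k + 1)) * E k s τ + Complex.I ^ (2 * k + 1) * F k s τ)

/-- The transformation law of weight `k + 1/2` with parameter `s` on `Γ₀(4)`:
`f(γτ) = v_ϑ(γ)^{2k+1} (cτ+d)^{k+1/2} |cτ+d|^{2s} f(τ)`. -/
def TransformsOn (k : ℤ) (s : ℂ) (f : ℍ → ℂ) : Prop :=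
  ∀ γ ∈ CongruenceSubgroup.Gamma0 4, ∀ τ : ℍ,
    f (γ • τ) = thetaMultiplier γ ^ (2 * k + 1) * autFactor γ τ ^ ((k : ℂ) + 1 / 2) *
      ((‖autFactor γ τ‖ : ℝ) : ℂ) ^ (2 * s) * f τ

end CohenEisenstein

end

noncomputable section

namespace CohenEisenstein

open scoped NumberTheorySymbols

/-! ### The Kronecker symbol -/

/-! `Γ₀(4)` is generated by `-1`, `T` and `U = lowerFour`, so the transformation law follows from
its cases `T` and `U` once the automorphy factor is known to be a cocycle under right multiplication
by these two matrices. No theta function is used. For `T`, the multiplier is unchanged because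
`(n/m)` has period `4n` in `m`, signs included (`kronecker_add_four_mul`). For `U`, the sign by
which `(c/d)` changes when `c` becomes `c + 4d` is exactly the branch sign in multiplying principal
square roots (`cpow_half_mul`).

The same facts govern `E`: its terms are odd powers of a root term, divided by an absolute value
factor, and `T`, `U` permute the index pairs by `(m, n) ↦ (m, n + m)` and `(m, n) ↦ ±(m + 4n, n)`.
The branch sign appears when `m + 4n < 0` and cancels the sign from negating the pair
(`rootTerm_neg_neg`). The Fricke involution takes `T` to `U⁻¹` and `U` to `T⁻¹`, so `F` inherits the
law from `E`, and `H` follows by linearity. Convergence is comparison with a lattice sum of exponent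
greater than 2. -/

theorem odd_natAbs {d : ℤ} (hd : Odd d) : Odd d.natAbs := Int.natAbs_odd.2 hd

theorem kronecker_neg_one {d : ℤ} (hd : Odd d) :
    kronecker (-1) d = if d % 4 = 1 then 1 else -1 := by
  have h2 : d % 2 = 1 := Int.odd_iff.1 hd
  have hc : (d.natAbs % 4 = 1 ∨ d.natAbs % 4 = 3) := by omega
  rw [kronecker, jacobiSym.at_neg_one (odd_natAbs hd)]
  rcases hc with hc | hc
  · rw [ZMod.χ₄_nat_one_mod_four hc]
    split_ifs <;> first | rfl | omega
  · rw [ZMod.χ₄_nat_three_mod_four hc]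
    split_ifs <;> first | rfl | omega

theorem kronecker_of_neg {n : ℤ} (hn : n < 0) (d : ℤ) :
    kronecker n d = kronecker (-1) d * kronecker (-n) d := by
  have h : jacobiSym n d.natAbs = jacobiSym (-1) d.natAbs * jacobiSym (-n) d.natAbs := by
    rw [← jacobiSym.mul_left]; simp
  have hn' : ¬ (-n < 0) := by omega
  simp only [kronecker, h, hn, hn']
  simp

theorem kronecker_trichotomy (n d : ℤ) :
    kronecker n d = 0 ∨ kronecker n d = 1 ∨ kronecker n d = -1 := by
  unfold kronecker
  rcases jacobiSym.trichotomy n d.natAbs with h | h | h <;> rw [h] <;> split_ifs <;> simp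

theorem kronecker_zpow_odd (n d k : ℤ) :
    (kronecker n d : ℂ) ^ (2 * k + 1) = kronecker n d := by
  have h0 : 2 * k + 1 ≠ 0 := by omega
  rcases kronecker_trichotomy n d with h | h | h <;> rw [h]
  · simp [zero_zpow _ h0]
  · simp
  · have : Odd (2 * k + 1) := ⟨k, rfl⟩
    simp [this.neg_one_zpow]

theorem kronecker_four_mul (n : ℤ) {d : ℤ} (hd : Odd d) :
    kronecker (4 * n) d = kronecker n d := by
  have : (4 * n < 0) ↔ n < 0 := by omega
  rw [kronecker, kronecker, jacobiSym.mul_left, jacobiSym.at_four (odd_natAbs hd), one_mul]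
  simp only [this]

/-- Since `b ≡ -a` modulo `4n`, `ab ≡ (4n - 1)a²`, and `(n/4n-1) = (4n/4n-1) = (1/4n-1) = 1`. Hence
`(n/a)(n/b) = 1` in the coprime case; otherwise both symbols vanish. This is the periodicity step
across zero. -/
theorem jacobiSym_eq_of_add_eq {n : ℤ} (hn : 0 < n) {a b : ℕ} (ha : Odd a) (hb : Odd b)
    (hab : (a : ℤ) + b = 4 * n) : J(n | a) = J(n | b) := by
  lift n to ℕ using hn.le
  have hn' : 0 < n := by exact_mod_cast hn
  have hab' : a + b = 4 * n := by exact_mod_cast hab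
  have ha0 := ha.pos
  have hb0 := hb.pos
  have hodd : Odd (4 * n - 1) := by rw [Nat.odd_iff]; omega
  have h1 : J((n : ℤ) | 4 * n - 1) = 1 := by
    have h : J(4 * (n : ℤ) | 4 * n - 1) = 1 := by
      rw [jacobiSym.mod_left' (a₂ := 1), jacobiSym.one_left]
      have : ((4 * n - 1 : ℕ) : ℤ) = 4 * n - 1 := by omega
      rw [this, ← Int.ModEq, Int.modEq_iff_dvd]
      exact ⟨-1, by ring⟩
    rwa [jacobiSym.mul_left, jacobiSym.at_four hodd, one_mul] at h
  by_cases hg : (n : ℤ).gcd a = 1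
  · have hprod : J((n : ℤ) | a * b) = 1 := by
      have hmod : a * b ≡ (4 * n - 1) * (a * a) [MOD 4 * n] := by
        rw [← Int.natCast_modEq_iff, Int.modEq_iff_dvd]
        have hb' : (b : ℤ) = 4 * n - a := by omega
        have h4 : ((4 * n - 1 : ℕ) : ℤ) = 4 * n - 1 := by omega
        push_cast [h4, hb']
        exact ⟨a * a - a, by ring⟩
      rw [jacobiSym.mod_right' n (ha.mul hb), hmod,
        ← jacobiSym.mod_right' n (hodd.mul (ha.mul ha)),
        jacobiSym.mul_right' _ (by omega) (by positivity),
        jacobiSym.mul_right' _ (by omega) (by omega), h1, one_mul, ← sq, jacobiSym.sq_one hg]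
    rw [jacobiSym.mul_right' _ (by omega) (by omega)] at hprod
    rcases jacobiSym.trichotomy (n : ℤ) a with h | h | h <;> rw [h] at hprod ⊢ <;> omega
  · have hg' : (n : ℤ).gcd b ≠ 1 := by
      intro h
      apply hg
      have : IsCoprime (n : ℤ) b := Int.isCoprime_iff_gcd_eq_one.2 h
      rw [← Int.isCoprime_iff_gcd_eq_one]
      have hb' : (a : ℤ) = -b + n * 4 := by omega
      rw [hb']
      exact (this.neg_right).add_mul_left_right 4
    rw [jacobiSym.eq_zero_iff.2 ⟨by omega, hg⟩, jacobiSym.eq_zero_iff.2 ⟨by omega, hg'⟩]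

theorem jacobiSym_eq_of_modEq {n : ℤ} {a b : ℕ} (ha : Odd a) (hb : Odd b)
    (hab : (a : ℤ) ≡ b [ZMOD 4 * n]) : J(n | a) = J(n | b) := by
  have h : a ≡ b [MOD 4 * n.natAbs] := by
    rw [← Int.natCast_modEq_iff, Int.modEq_iff_dvd]
    rw [Int.modEq_iff_dvd] at hab
    rw [← Int.natAbs_dvd, Int.natAbs_mul] at hab
    simpa using hab
  rw [jacobiSym.mod_right n ha, h, ← jacobiSym.mod_right n hb]

/-- The symbol `(n/m)` is periodic in `m` modulo `4n`, signs included. -/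
theorem kronecker_add_four_mul (n : ℤ) {m : ℤ} (hm : Odd m) :
    kronecker n (m + 4 * n) = kronecker n m := by
  have hm' : Odd (m + 4 * n) := hm.add_even ⟨2 * n, by ring⟩
  have hpos : ∀ l : ℤ, 0 < l → (∀ m : ℤ, Odd m → kronecker l (m + 4 * l) = kronecker l m) := by
    intro l hl m hm
    have hm' : Odd (m + 4 * l) := hm.add_even ⟨2 * l, by ring⟩
    have hl' : ¬ l < 0 := by omega
    simp only [kronecker, hl', false_and, if_false, one_mul]
    -- If the shift crosses zero, the absolute values add up to `4l`; otherwise they are congruent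
    -- modulo `4l`.
    by_cases h : m < 0 ∧ 0 ≤ m + 4 * l
    · exact (jacobiSym_eq_of_add_eq hl (odd_natAbs hm) (odd_natAbs hm') (by omega)).symm
    · apply jacobiSym_eq_of_modEq (odd_natAbs hm') (odd_natAbs hm)
      rw [Int.modEq_iff_dvd]
      by_cases h0 : 0 ≤ m
      · exact ⟨-1, by omega⟩
      · exact ⟨1, by omega⟩
  rcases lt_trichotomy n 0 with h | rfl | h
  · have h4 : (m + 4 * n) % 4 = m % 4 := by omega
    rw [kronecker_of_neg h, kronecker_of_neg h m, kronecker_neg_one hm', kronecker_neg_one hm, h4]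
    have := hpos (-n) (by omega) (m + 4 * n) hm'
    rw [show m + 4 * n + 4 * -n = m by ring] at this
    rw [this]
  · simp
  · exact hpos n h m hm

theorem eps_eq {d : ℤ} (hd : Odd d) : eps d = if d % 4 = 1 then 1 else Complex.I := by
  rw [eps, kronecker_neg_one hd]
  split_ifs
  · simp
  · have : ((-1 : ℤ) : ℂ) = -1 := by simp
    rw [this, Complex.cpow_def_of_ne_zero (by simp), Complex.log_neg_one,
      show (Real.pi : ℂ) * Complex.I * (1 / 2) = Real.pi / 2 * Complex.I by ring,
      Complex.exp_pi_div_two_mul_I]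

theorem norm_eps {d : ℤ} (hd : Odd d) : ‖eps d‖ = 1 := by
  rw [eps_eq hd]; split_ifs <;> simp

theorem eps_add_four_mul {m : ℤ} (hm : Odd m) (n : ℤ) : eps (m + 4 * n) = eps m := by
  have hm' : Odd (m + 4 * n) := hm.add_even ⟨2 * n, by ring⟩
  rw [eps_eq hm, eps_eq hm', show (m + 4 * n) % 4 = m % 4 by omega]

/-- The Jacobi part is periodic in the numerator, so only the extra sign can change: this happens
when `d < 0` and exactly one of the two numerators is negative. -/
theorem kronecker_add_mul_left (c t : ℤ) (d : ℤ) :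
    kronecker (c + t * d) d =
      (if d < 0 ∧ (c < 0 ↔ ¬ c + t * d < 0) then -1 else 1) * kronecker c d := by
  have h : J(c + t * d | d.natAbs) = J(c | d.natAbs) := by
    apply jacobiSym.mod_left'
    rw [← Int.ModEq, Int.modEq_iff_dvd, Int.natAbs_dvd]
    exact ⟨-t, by ring⟩
  unfold kronecker
  rw [h]
  by_cases h1 : d < 0 <;> by_cases h2 : c < 0 <;> by_cases h3 : c + t * d < 0 <;>
    simp [h1, h2, h3]

/-! ### Principal square roots -/

theorem exp_cpow_half {x : ℂ} (h₁ : -Real.pi < x.im) (h₂ : x.im ≤ Real.pi) :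
    Complex.exp x ^ (1 / 2 : ℂ) = Complex.exp (x / 2) := by
  rw [Complex.cpow_def_of_ne_zero (Complex.exp_ne_zero _), Complex.log_exp h₁ h₂]
  congr 1; ring

/-- As `0 < arg w < π`, the sum `arg z + arg w` is greater than `-π`; it exceeds `π` exactly under
the stated sign condition, and subtracting `2π` then costs a factor `-1`. -/
theorem cpow_half_mul {z w : ℂ} (hz : z ≠ 0) (hw : 0 < w.im) :
    z ^ (1 / 2 : ℂ) * w ^ (1 / 2 : ℂ) =
      (if 0 ≤ z.im ∧ (z * w).im < 0 then -1 else 1) * (z * w) ^ (1 / 2 : ℂ) := by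
  have hw0 : w ≠ 0 := by rintro rfl; simp at hw
  have hprod : z * w = Complex.exp (Complex.log z + Complex.log w) := by
    rw [Complex.exp_add, Complex.exp_log hz, Complex.exp_log hw0]
  have hl : z ^ (1 / 2 : ℂ) * w ^ (1 / 2 : ℂ) =
      Complex.exp ((Complex.log z + Complex.log w) / 2) := by
    rw [Complex.cpow_def_of_ne_zero hz, Complex.cpow_def_of_ne_zero hw0, ← Complex.exp_add]
    congr 1; ring
  have hwpos : 0 < w.arg := by
    refine lt_of_le_of_ne (Complex.arg_nonneg_iff.2 hw.le) fun h => ?_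
    rw [eq_comm, Complex.arg_eq_zero_iff] at h
    exact hw.ne' h.2
  have hwpi : w.arg < Real.pi := Complex.arg_lt_pi_iff.2 (Or.inr hw.ne')
  have him : (Complex.log z + Complex.log w).im = z.arg + w.arg := by simp [Complex.log_im]
  have hre : (z * w).im = Real.exp (Complex.log z + Complex.log w).re *
      Real.sin (z.arg + w.arg) := by
    rw [hprod, Complex.exp_im, him]
  have hzpi := Complex.arg_le_pi z
  have hzpi' := Complex.neg_pi_lt_arg z
  rw [hl]
  split_ifs with h
  · have h0 : 0 ≤ z.arg := Complex.arg_nonneg_iff.2 h.1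
    have hgt : Real.pi < z.arg + w.arg := by
      by_contra hle
      have := Real.sin_nonneg_of_nonneg_of_le_pi (by linarith) (not_lt.1 hle)
      have h2 := h.2
      rw [hre] at h2
      exact absurd h2 (not_lt.2 (by positivity))
    have hprod' : z * w =
        Complex.exp (Complex.log z + Complex.log w - 2 * Real.pi * Complex.I) := by
      rw [Complex.exp_periodic.sub_eq, hprod]
    have him' : (Complex.log z + Complex.log w - 2 * Real.pi * Complex.I).im =
        z.arg + w.arg - 2 * Real.pi := by simp [Complex.log_im]
    rw [hprod', exp_cpow_half (by rw [him']; linarith) (by rw [him']; linarith),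
      show (Complex.log z + Complex.log w - 2 * Real.pi * Complex.I) / 2 =
        (Complex.log z + Complex.log w) / 2 - Real.pi * Complex.I by ring,
      Complex.exp_sub_pi_mul_I]
    ring
  · have hle : z.arg + w.arg ≤ Real.pi := by
      by_contra hgt
      push Not at hgt
      apply h
      have h0 : 0 ≤ z.im := Complex.arg_nonneg_iff.1 (by linarith)
      refine ⟨h0, ?_⟩
      rw [hre]
      have hs : Real.sin (z.arg + w.arg) < 0 := by
        rw [← Real.sin_sub_two_pi]
        exact Real.sin_neg_of_neg_of_neg_pi_lt (by linarith) (by linarith)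
      exact mul_neg_of_pos_of_neg (Real.exp_pos _) hs
    rw [one_mul, hprod, exp_cpow_half (by rw [him]; linarith) (by rw [him]; linarith)]

theorem cpow_half_neg {z : ℂ} (hz : 0 < z.im) :
    z ^ (1 / 2 : ℂ) = Complex.I * (-z) ^ (1 / 2 : ℂ) := by
  have h := cpow_half_mul (z := -1) (w := z) (by simp) hz
  have hI : (-1 : ℂ) ^ (1 / 2 : ℂ) = Complex.I := by
    rw [Complex.cpow_def_of_ne_zero (by simp), Complex.log_neg_one,
      show (Real.pi : ℂ) * Complex.I * (1 / 2) = Real.pi / 2 * Complex.I by ring,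
      Complex.exp_pi_div_two_mul_I]
  rw [hI, if_pos (by simpa using hz), neg_one_mul z] at h
  linear_combination -Complex.I * h + z ^ (1 / 2 : ℂ) * Complex.I_sq

theorem cpow_add_half (z : ℂ) (k : ℤ) :
    z ^ ((k : ℂ) + 1 / 2) = (z ^ (1 / 2 : ℂ)) ^ (2 * k + 1) := by
  rw [← Complex.cpow_mul_int]
  congr 1
  push_cast
  ring

/-! ### The automorphy factor and its cocycle relation along generators of `Γ₀(4)` -/

/-- The full automorphy factor `v_ϑ(γ)^{2k+1} (cτ+d)^{k+1/2} |cτ+d|^{2s}`. -/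
def autWeight (k : ℤ) (s : ℂ) (γ : SL(2, ℤ)) (τ : ℍ) : ℂ :=
  thetaMultiplier γ ^ (2 * k + 1) * autFactor γ τ ^ ((k : ℂ) + 1 / 2) *
    ((‖autFactor γ τ‖ : ℝ) : ℂ) ^ (2 * s)

/-- The matrix `[[1, 0], [4, 1]]`. -/
def lowerFour : SL(2, ℤ) := ⟨!![1, 0; 4, 1], by simp [Matrix.det_fin_two_of]⟩

theorem autWeight_eq (k : ℤ) (s : ℂ) (γ : SL(2, ℤ)) (τ : ℍ) :
    autWeight k s γ τ = (thetaMultiplier γ * autFactor γ τ ^ (1 / 2 : ℂ)) ^ (2 * k + 1) *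
      ((‖autFactor γ τ‖ : ℝ) : ℂ) ^ (2 * s) := by
  rw [autWeight, cpow_add_half, mul_zpow]

theorem linear_ne_zero {c d : ℤ} (h : c ≠ 0 ∨ d ≠ 0) (τ : ℍ) : (c : ℂ) * τ + d ≠ 0 := by
  intro h0
  have him := congrArg Complex.im h0
  have hre := congrArg Complex.re h0
  simp [τ.im_ne_zero] at him
  subst him
  simp at hre
  omega

theorem coe_smul_eq (γ : SL(2, ℤ)) (τ : ℍ) :
    ((γ • τ : ℍ) : ℂ) = ((γ 0 0 : ℂ) * τ + γ 0 1) / autFactor γ τ := by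
  rw [coe_specialLinearGroup_apply]; simp [autFactor]

theorem coe_T_smul (τ : ℍ) : ((ModularGroup.T • τ : ℍ) : ℂ) = τ + 1 := by
  rw [coe_smul_eq]; simp [autFactor, ModularGroup.T]

theorem autFactor_lowerFour (τ : ℍ) : autFactor lowerFour τ = 4 * τ + 1 := by
  simp [autFactor, lowerFour]

theorem coe_lowerFour_smul (τ : ℍ) : ((lowerFour • τ : ℍ) : ℂ) = τ / (4 * τ + 1) := by
  rw [coe_smul_eq, autFactor_lowerFour]; simp [lowerFour]

theorem im_four_mul_add_one_pos (τ : ℍ) : 0 < (4 * (τ : ℂ) + 1).im := by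
  simpa using τ.im_pos

theorem four_mul_add_one_ne_zero (τ : ℍ) : 4 * (τ : ℂ) + 1 ≠ 0 := by
  simpa using linear_ne_zero (c := 4) (d := 1) (by simp) τ

/-- `c·Uτ + d` times `4τ + 1`, for `U = lowerFour`. -/
theorem linear_lowerFour_mul (c d : ℤ) (τ : ℍ) :
    ((c : ℂ) * (lowerFour • τ : ℍ) + d) * (4 * τ + 1) = ((c + 4 * d : ℤ) : ℂ) * τ + d := by
  have := four_mul_add_one_ne_zero τ
  rw [coe_lowerFour_smul, add_mul, mul_assoc, div_mul_cancel₀ _ this]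
  push_cast
  ring

theorem linear_im_nonneg_iff (c d : ℤ) (τ : ℍ) : 0 ≤ ((c : ℂ) * τ + d).im ↔ 0 ≤ c := by
  have := τ.im_pos
  simp only [Complex.add_im, Complex.mul_im, Complex.intCast_re, Complex.intCast_im, zero_mul,
    add_zero, coe_im]
  rw [mul_nonneg_iff_of_pos_right this, Int.cast_nonneg_iff]

theorem linear_im_pos_iff (c d : ℤ) (τ : ℍ) : 0 < ((c : ℂ) * τ + d).im ↔ 0 < c := by
  have := τ.im_pos
  simp only [Complex.add_im, Complex.mul_im, Complex.intCast_re, Complex.intCast_im, zero_mul,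
    add_zero, coe_im]
  rw [mul_pos_iff_of_pos_right this, Int.cast_pos]

theorem linear_im_neg_iff (c d : ℤ) (τ : ℍ) : ((c : ℂ) * τ + d).im < 0 ↔ c < 0 := by
  rw [← not_le, linear_im_nonneg_iff, not_le]

theorem cpow_half_linear_lowerFour {c d : ℤ} (h : c ≠ 0 ∨ d ≠ 0) (τ : ℍ) :
    ((c : ℂ) * (lowerFour • τ : ℍ) + d) ^ (1 / 2 : ℂ) * (4 * (τ : ℂ) + 1) ^ (1 / 2 : ℂ) =
      (if 0 ≤ c ∧ c + 4 * d < 0 then -1 else 1) *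
        (((c + 4 * d : ℤ) : ℂ) * τ + d) ^ (1 / 2 : ℂ) := by
  rw [cpow_half_mul (linear_ne_zero h _) (im_four_mul_add_one_pos τ), linear_lowerFour_mul]
  simp only [linear_im_nonneg_iff, linear_im_neg_iff]

theorem mul_T_apply (γ : SL(2, ℤ)) :
    (γ * ModularGroup.T) 1 0 = γ 1 0 ∧ (γ * ModularGroup.T) 1 1 = γ 1 1 + γ 1 0 := by
  rw [Matrix.SpecialLinearGroup.coe_mul]
  simp [ModularGroup.T, Matrix.mul_apply, Fin.sum_univ_two, add_comm]

theorem mul_lowerFour_apply (γ : SL(2, ℤ)) :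
    (γ * lowerFour) 1 0 = γ 1 0 + 4 * γ 1 1 ∧ (γ * lowerFour) 1 1 = γ 1 1 := by
  rw [Matrix.SpecialLinearGroup.coe_mul]
  simp [lowerFour, Matrix.mul_apply, Fin.sum_univ_two, mul_comm]

theorem autFactor_mul_T (γ : SL(2, ℤ)) (τ : ℍ) :
    autFactor (γ * ModularGroup.T) τ = autFactor γ (ModularGroup.T • τ) := by
  rw [autFactor, autFactor, (mul_T_apply γ).1, (mul_T_apply γ).2, coe_T_smul]
  push_cast
  ring

theorem odd_of_four_dvd {γ : SL(2, ℤ)} (h : 4 ∣ γ 1 0) : Odd (γ 1 1) := by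
  have hdet := γ.det_coe
  rw [Matrix.det_fin_two] at hdet
  obtain ⟨e, he⟩ := h
  by_contra hd
  obtain ⟨f, hf⟩ := Int.not_odd_iff_even.1 hd
  rw [he, hf] at hdet
  have h2 : γ 0 0 * (f + f) - γ 0 1 * (4 * e) = 2 * (γ 0 0 * f - γ 0 1 * (2 * e)) := by ring
  rw [h2] at hdet
  omega

theorem autWeight_T (k : ℤ) (s : ℂ) (τ : ℍ) : autWeight k s ModularGroup.T τ = 1 := by
  rw [autWeight]
  have h1 : autFactor ModularGroup.T τ = 1 := by simp [autFactor, ModularGroup.T]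
  have h2 : thetaMultiplier ModularGroup.T = 1 := by
    simp [thetaMultiplier, ModularGroup.T, eps, kronecker]
  rw [h1, h2]
  simp

theorem autWeight_lowerFour (k : ℤ) (s : ℂ) (τ : ℍ) :
    autWeight k s lowerFour τ = ((4 * (τ : ℂ) + 1) ^ (1 / 2 : ℂ)) ^ (2 * k + 1) *
      ((‖4 * (τ : ℂ) + 1‖ : ℝ) : ℂ) ^ (2 * s) := by
  have h2 : thetaMultiplier lowerFour = 1 := by
    simp [thetaMultiplier, lowerFour, eps, kronecker]
  rw [autWeight_eq, autFactor_lowerFour, h2, one_mul]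

theorem autWeight_mul_T (k : ℤ) (s : ℂ) {γ : SL(2, ℤ)} (hγ : 4 ∣ γ 1 0) (τ : ℍ) :
    autWeight k s (γ * ModularGroup.T) τ =
      autWeight k s γ (ModularGroup.T • τ) * autWeight k s ModularGroup.T τ := by
  have hd := odd_of_four_dvd hγ
  obtain ⟨e, he⟩ := hγ
  have h : thetaMultiplier (γ * ModularGroup.T) = thetaMultiplier γ := by
    have hd' : Odd (γ 1 1 + 4 * e) := hd.add_even ⟨2 * e, by ring⟩
    rw [thetaMultiplier, thetaMultiplier, (mul_T_apply γ).1, (mul_T_apply γ).2, he,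
      kronecker_four_mul _ hd', kronecker_four_mul _ hd, kronecker_add_four_mul _ hd,
      eps_add_four_mul hd]
  rw [autWeight_T, mul_one, autWeight, autWeight, autFactor_mul_T, h]

theorem autWeight_mul_lowerFour (k : ℤ) (s : ℂ) {γ : SL(2, ℤ)} (hγ : 4 ∣ γ 1 0) (τ : ℍ) :
    autWeight k s (γ * lowerFour) τ =
      autWeight k s γ (lowerFour • τ) * autWeight k s lowerFour τ := by
  have hd := odd_of_four_dvd hγ
  have hd0 : γ 1 1 ≠ 0 := by rintro h; simp [h] at hd
  have hmul : autFactor (γ * lowerFour) τ = autFactor γ (lowerFour • τ) * (4 * τ + 1) := by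
    rw [autFactor, autFactor, linear_lowerFour_mul, (mul_lowerFour_apply γ).1,
      (mul_lowerFour_apply γ).2]
  have hroot : thetaMultiplier (γ * lowerFour) * autFactor (γ * lowerFour) τ ^ (1 / 2 : ℂ) =
      thetaMultiplier γ * autFactor γ (lowerFour • τ) ^ (1 / 2 : ℂ) *
        (4 * (τ : ℂ) + 1) ^ (1 / 2 : ℂ) := by
    rw [mul_assoc (thetaMultiplier γ), autFactor, autFactor,
      cpow_half_linear_lowerFour (Or.inr hd0), thetaMultiplier, thetaMultiplier,
      (mul_lowerFour_apply γ).1, (mul_lowerFour_apply γ).2, kronecker_add_mul_left]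
    -- The sign change of the symbol and the branch sign of the square root occur under the same
    -- condition.
    have hiff : (γ 1 1 < 0 ∧ (γ 1 0 < 0 ↔ ¬ γ 1 0 + 4 * γ 1 1 < 0)) ↔
        (0 ≤ γ 1 0 ∧ γ 1 0 + 4 * γ 1 1 < 0) := by omega
    simp only [hiff]
    push_cast
    ring
  rw [autWeight_eq, autWeight_eq k s γ, autWeight_lowerFour, hroot, hmul, mul_zpow, norm_mul,
    Complex.ofReal_mul, Complex.mul_cpow_ofReal_nonneg (norm_nonneg _) (norm_nonneg _)]
  ring

theorem autWeight_of_eq_zero (k : ℤ) (s : ℂ) {γ : SL(2, ℤ)} (hc : γ 1 0 = 0)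
    (hd : γ 1 1 = 1 ∨ γ 1 1 = -1) (τ : ℍ) : autWeight k s γ τ = 1 := by
  rw [autWeight_eq, thetaMultiplier, autFactor, hc]
  rcases hd with hd | hd <;> rw [hd]
  · simp [kronecker, eps]
  · have : eps (-1) = Complex.I := by rw [eps_eq (by decide)]; simp
    rw [this]
    have hI : (-1 : ℂ) ^ (1 / 2 : ℂ) = Complex.I := by
      have := eps_eq (d := -1) (by decide)
      simpa [eps, kronecker_neg_one] using this
    simp only [Int.cast_zero, zero_mul, zero_add, Int.cast_neg, Int.cast_one, hI]
    simp [kronecker]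

/-! ### Reduction of the transformation law to generators -/

/-- An equivalence, so that the descent may multiply by `g` or by `g⁻¹` using only the cocycle
relation for `g`. -/
theorem transforms_mul_iff {W : SL(2, ℤ) → ℍ → ℂ} {f : ℍ → ℂ} {γ g : SL(2, ℤ)}
    (hW : ∀ τ, W (γ * g) τ = W γ (g • τ) * W g τ) (hg : ∀ τ, f (g • τ) = W g τ * f τ) :
    (∀ τ, f ((γ * g) • τ) = W (γ * g) τ * f τ) ↔ ∀ τ, f (γ • τ) = W γ τ * f τ := by
  constructor
  · intro h τ
    have := h (g⁻¹ • τ)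
    rwa [hW, mul_assoc, ← hg, mul_smul, smul_inv_smul] at this
  · intro h τ
    rw [mul_smul, h, hg, hW, mul_assoc]

theorem transformsOn_of_generators {k : ℤ} {s : ℂ} {f : ℍ → ℂ}
    (hT : ∀ τ, f (ModularGroup.T • τ) = f τ)
    (hU : ∀ τ, f (lowerFour • τ) = autWeight k s lowerFour τ * f τ) : TransformsOn k s f := by
  have hT' : ∀ τ, f (ModularGroup.T • τ) = autWeight k s ModularGroup.T τ * f τ := by
    intro τ; rw [autWeight_T, one_mul, hT]
  have hTz : ∀ (b : ℤ) τ, f (ModularGroup.T ^ b • τ) = f τ := by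
    intro b
    induction b with
    | zero => simp
    | succ n ih => intro τ; rw [zpow_add_one, mul_smul, ih, hT]
    | pred n ih =>
      intro τ
      rw [zpow_sub_one, mul_smul, ih, ← hT (ModularGroup.T⁻¹ • τ), smul_inv_smul]
  -- Euclidean descent on `|c| + |d|`; the case `N = 0` is void because `d` is odd.
  have key : ∀ (N : ℕ) (γ : SL(2, ℤ)), 4 ∣ γ 1 0 → (γ 1 0).natAbs + (γ 1 1).natAbs ≤ N →
      ∀ τ, f (γ • τ) = autWeight k s γ τ * f τ := by
    intro N
    induction N with
    | zero =>
      intro γ hγ hN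
      have := odd_of_four_dvd hγ
      rw [Int.odd_iff] at this
      omega
    | succ N ih =>
      intro γ hγ hN
      have hd := odd_of_four_dvd hγ
      rw [Int.odd_iff] at hd
      have hTi : ∀ γ : SL(2, ℤ), (γ * ModularGroup.T⁻¹) 1 0 = γ 1 0 ∧
          (γ * ModularGroup.T⁻¹) 1 1 = γ 1 1 - γ 1 0 := by
        intro γ
        have h := mul_T_apply (γ * ModularGroup.T⁻¹)
        rw [inv_mul_cancel_right] at h
        omega
      have hUi : ∀ γ : SL(2, ℤ), (γ * lowerFour⁻¹) 1 0 = γ 1 0 - 4 * γ 1 1 ∧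
          (γ * lowerFour⁻¹) 1 1 = γ 1 1 := by
        intro γ
        have h := mul_lowerFour_apply (γ * lowerFour⁻¹)
        rw [inv_mul_cancel_right] at h
        omega
      have stepT : (γ 1 1 + γ 1 0).natAbs < (γ 1 1).natAbs →
          ∀ τ, f (γ • τ) = autWeight k s γ τ * f τ := fun h =>
        (transforms_mul_iff (fun τ => autWeight_mul_T k s hγ τ) hT').1
          (ih _ (by rw [(mul_T_apply γ).1]; exact hγ)
            (by rw [(mul_T_apply γ).1, (mul_T_apply γ).2]; omega))
      have stepU : (γ 1 0 + 4 * γ 1 1).natAbs < (γ 1 0).natAbs →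
          ∀ τ, f (γ • τ) = autWeight k s γ τ * f τ := fun h =>
        (transforms_mul_iff (fun τ => autWeight_mul_lowerFour k s hγ τ) hU).1
          (ih _ (by rw [(mul_lowerFour_apply γ).1]; omega)
            (by rw [(mul_lowerFour_apply γ).1, (mul_lowerFour_apply γ).2]; omega))
      have stepTi : (γ 1 1 - γ 1 0).natAbs < (γ 1 1).natAbs →
          ∀ τ, f (γ • τ) = autWeight k s γ τ * f τ := fun h => by
        have hdiv : 4 ∣ (γ * ModularGroup.T⁻¹) 1 0 := by rw [(hTi γ).1]; exact hγ
        have := (transforms_mul_iff (fun τ => autWeight_mul_T k s hdiv τ) hT').2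
          (ih _ hdiv (by rw [(hTi γ).1, (hTi γ).2]; omega))
        rwa [inv_mul_cancel_right] at this
      have stepUi : (γ 1 0 - 4 * γ 1 1).natAbs < (γ 1 0).natAbs →
          ∀ τ, f (γ • τ) = autWeight k s γ τ * f τ := fun h => by
        have hdiv : 4 ∣ (γ * lowerFour⁻¹) 1 0 := by rw [(hUi γ).1]; omega
        have := (transforms_mul_iff (fun τ => autWeight_mul_lowerFour k s hdiv τ) hU).2
          (ih _ hdiv (by rw [(hUi γ).1, (hUi γ).2]; omega))
        rwa [inv_mul_cancel_right] at this
      by_cases hc : γ 1 0 = 0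
      · have hdet := γ.det_coe
        rw [Matrix.det_fin_two, hc, mul_zero, sub_zero] at hdet
        have hd1 := Int.isUnit_iff.1 (IsUnit.of_mul_eq_one_right _ hdet)
        intro τ
        -- Here `a = d = ±1`, so `γ` acts as translation by `b/d = bd`.
        rw [autWeight_of_eq_zero k s hc hd1, one_mul, ← hTz (γ 0 1 * γ 1 1) τ]
        congr 1
        ext1
        rw [modular_T_zpow_smul, coe_vadd, coe_smul_eq, autFactor, hc]
        rcases hd1 with hd1 | hd1 <;> rw [hd1] at hdet ⊢
        · have ha : γ 0 0 = 1 := by omega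
          rw [ha]; push_cast; ring
        · have ha : γ 0 0 = -1 := by omega
          rw [ha]; push_cast; ring
      -- A `T`-step reduces `|d|` if `|c| < 2|d|`, a `U`-step reduces `|c|` if `|c| > 2|d|`;
      -- equality is impossible since `4 ∣ c` and `d` is odd.
      · have hcases : (γ 1 1 + γ 1 0).natAbs < (γ 1 1).natAbs ∨
            (γ 1 1 - γ 1 0).natAbs < (γ 1 1).natAbs ∨
            (γ 1 0 + 4 * γ 1 1).natAbs < (γ 1 0).natAbs ∨
            (γ 1 0 - 4 * γ 1 1).natAbs < (γ 1 0).natAbs := by omega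
        rcases hcases with h | h | h | h
        exacts [stepT h, stepTi h, stepU h, stepUi h]
  intro γ hγ τ
  have h4 : 4 ∣ γ 1 0 := by
    rw [CongruenceSubgroup.Gamma0_mem] at hγ
    exact (ZMod.intCast_zmod_eq_zero_iff_dvd _ 4).1 hγ
  exact key _ γ h4 le_rfl τ

/-! ### Absolute convergence -/

theorem norm_ETerm_le {k : ℤ} {s : ℂ} {τ : ℍ} {m n : ℤ} (hm : Odd m) :
    ‖ETerm k s τ m n‖ ≤ ‖(m : ℂ) * τ + n‖ ^ (-((k : ℝ) + 1 / 2 + 2 * s.re)) := by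
  have hm0 : m ≠ 0 := by rintro rfl; simp at hm
  have hz := linear_ne_zero (c := m) (d := n) (Or.inl hm0) τ
  have hz' : 0 < ‖(m : ℂ) * τ + n‖ := norm_pos_iff.2 hz
  have hk : ‖(kronecker n m : ℂ)‖ ≤ 1 := by
    rcases kronecker_trichotomy n m with h | h | h <;> rw [h] <;> simp
  have hpow : ‖((m : ℂ) * τ + n) ^ ((k : ℂ) + 1 / 2)‖ =
      ‖(m : ℂ) * τ + n‖ ^ ((k : ℝ) + 1 / 2) := by
    have him : ((k : ℂ) + 1 / 2).im = 0 := by simp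
    have hre : ((k : ℂ) + 1 / 2).re = (k : ℝ) + 1 / 2 := by simp
    rw [Complex.norm_cpow_of_ne_zero hz, him, hre]
    simp
  have hs : (2 * s).re = 2 * s.re := by simp
  rw [ETerm, norm_div, norm_mul, norm_mul, norm_zpow, norm_eps hm, one_zpow, mul_one, hpow,
    Complex.norm_cpow_eq_rpow_re_of_pos hz', hs, ← Real.rpow_add hz', Real.rpow_neg hz'.le,
    ← one_div]
  gcongr

/-- The terms are bounded by `|mτ + n|^(-r)` with `r = k + 1/2 + 2 Re s > 2`, hence by a constant
times the corresponding power of the sup norm on `ℤ²`. -/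
theorem summable_norm_ETerm {k : ℤ} {s : ℂ} (hs : 3 / 4 - (k : ℝ) / 2 < s.re) (τ : ℍ) :
    Summable fun p : EIndex => ‖ETerm k s τ p.1.1 p.1.2‖ := by
  have h2 : 2 < (k : ℝ) + 1 / 2 + 2 * s.re := by linarith
  have hsum := (EisensteinSeries.summable_one_div_norm_rpow h2).mul_left
    (EisensteinSeries.r τ ^ (-((k : ℝ) + 1 / 2 + 2 * s.re)))
  have hinj : Function.Injective fun p : EIndex => ![p.1.1, p.1.2] := by
    intro p q h
    have h0 := congrFun h 0
    have h1 := congrFun h 1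
    simp only [Matrix.cons_val_zero, Matrix.cons_val_one] at h0 h1
    exact Subtype.ext (Prod.ext h0 h1)
  refine (hsum.comp_injective hinj).of_nonneg_of_le (fun _ => norm_nonneg _) fun p => ?_
  refine (norm_ETerm_le p.2.2.1).trans ?_
  simpa using EisensteinSeries.summand_bound τ (zero_le_two.trans h2.le) ![p.1.1, p.1.2]

/-! ### The transformation law of `E` -/

/-- The quantity `(n/m) ε_m⁻¹ (mτ+n)^{-1/2}` underlying the terms of the series. -/
def rootTerm (τ : ℍ) (m n : ℤ) : ℂ :=
  (kronecker n m : ℂ) * (eps m)⁻¹ / ((m : ℂ) * τ + n) ^ (1 / 2 : ℂ)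

/-- An odd power does not change a symbol in `{0, 1, -1}`, so sign questions for every `k` reduce to
`rootTerm`. -/
theorem ETerm_eq (k : ℤ) (s : ℂ) (τ : ℍ) (m n : ℤ) :
    ETerm k s τ m n =
      rootTerm τ m n ^ (2 * k + 1) / ((‖(m : ℂ) * τ + n‖ : ℝ) : ℂ) ^ (2 * s) := by
  rw [ETerm, rootTerm, div_zpow, mul_zpow, kronecker_zpow_odd, cpow_add_half, inv_zpow', div_div,
    show -(2 * k + 1) = -2 * k - 1 by ring]

theorem rootTerm_T_smul (τ : ℍ) {m : ℤ} (hm : 0 < m) (n : ℤ) :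
    rootTerm (ModularGroup.T • τ) m n = rootTerm τ m (n + m) := by
  have h := kronecker_add_mul_left n 1 m
  rw [if_neg (by omega), one_mul, one_mul] at h
  rw [rootTerm, rootTerm, h, coe_T_smul]
  push_cast
  ring_nf

theorem rootTerm_lowerFour_smul (τ : ℍ) {m : ℤ} (hm : 0 < m) (hodd : Odd m) (n : ℤ) :
    rootTerm (lowerFour • τ) m n = (if m + 4 * n < 0 then -1 else 1) *
      (4 * (τ : ℂ) + 1) ^ (1 / 2 : ℂ) * rootTerm τ (m + 4 * n) n := by
  have h := cpow_half_linear_lowerFour (c := m) (d := n) (Or.inl hm.ne') τ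
  have hodd' : Odd (m + 4 * n) := hodd.add_even ⟨2 * n, by ring⟩
  have hne : m + 4 * n ≠ 0 := by rintro h; simp [h] at hodd'
  have h0 : (m : ℂ) * (lowerFour • τ : ℍ) + n ≠ 0 := linear_ne_zero (Or.inl hm.ne') _
  have h1 : (((m + 4 * n : ℤ) : ℂ) * τ + n) ≠ 0 := linear_ne_zero (Or.inl hne) _
  have h0' : ((m : ℂ) * (lowerFour • τ : ℍ) + n) ^ (1 / 2 : ℂ) ≠ 0 := by
    simpa [Complex.cpow_eq_zero_iff] using h0
  have h1' : (((m + 4 * n : ℤ) : ℂ) * τ + n) ^ (1 / 2 : ℂ) ≠ 0 := by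
    rw [Ne, Complex.cpow_eq_zero_iff]; tauto
  rw [rootTerm, rootTerm, kronecker_add_four_mul n hodd, eps_add_four_mul hodd, mul_div_assoc',
    div_eq_div_iff h0' h1']
  simp only [hm.le, true_and] at h
  split_ifs at h ⊢
  · linear_combination (kronecker n m : ℂ) * (eps m)⁻¹ * h
  · linear_combination (-(kronecker n m : ℂ) * (eps m)⁻¹) * h

/-- The signs and powers of `i` from `(-1/m)`, from `ε_m` against `ε_{-m}`, and from the square root
of `-z` combine to `-1` in both classes modulo 4. -/
theorem rootTerm_neg_neg (τ : ℍ) {m n : ℤ} (hm : m < 0) (hodd : Odd m) (hn : n < 0) :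
    rootTerm τ (-m) (-n) = -rootTerm τ m n := by
  have him : 0 < (((-m : ℤ) : ℂ) * τ + (-n : ℤ)).im := (linear_im_pos_iff _ _ _).2 (by omega)
  have hroot := cpow_half_neg him
  have hneg : -(((-m : ℤ) : ℂ) * τ + (-n : ℤ)) = (m : ℂ) * τ + n := by push_cast; ring
  rw [hneg] at hroot
  have hk : kronecker (-n) m = kronecker (-n) (-m) := by
    have : ¬ (-n < 0) := by omega
    simp only [kronecker, this, false_and, if_false, Int.natAbs_neg]
  have h2 := Int.odd_iff.1 hodd
  rw [rootTerm, rootTerm, hroot, kronecker_of_neg hn, hk, kronecker_neg_one hodd, eps_eq hodd,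
    eps_eq hodd.neg]
  by_cases h4 : m % 4 = 1
  · have h4' : ¬ (-m) % 4 = 1 := by omega
    simp only [h4, h4', if_true, if_false]
    simp only [one_mul, inv_one, mul_one, Complex.inv_I, div_eq_mul_inv, mul_inv]
    linear_combination (kronecker (-n) (-m) : ℂ) *
      (((m : ℂ) * τ + n) ^ (2⁻¹ : ℂ))⁻¹ * Complex.I_mul_I
  · have h4' : (-m) % 4 = 1 := by omega
    simp only [h4, h4', if_true, if_false]
    simp only [Int.cast_neg, neg_mul, one_mul, inv_one, mul_one, Complex.inv_I,
      div_eq_mul_inv, mul_inv]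
    ring

/-- The map `(m, n) ↦ (m, n + m)` on index pairs. -/
def shiftEquiv : EIndex ≃ EIndex where
  toFun p := ⟨(p.1.1, p.1.2 + p.1.1), p.2.1, p.2.2.1, by simpa using p.2.2.2⟩
  invFun p := ⟨(p.1.1, p.1.2 - p.1.1), p.2.1, p.2.2.1, by simpa using p.2.2.2⟩
  left_inv p := by simp
  right_inv p := by simp

theorem E_T_smul (k : ℤ) (s : ℂ) (τ : ℍ) : E k s (ModularGroup.T • τ) = E k s τ := by
  rw [E, E, ← shiftEquiv.tsum_eq fun p : EIndex => ETerm k s τ p.1.1 p.1.2]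
  refine tsum_congr fun p => ?_
  have hm : 0 < p.1.1 := p.2.1
  simp only [shiftEquiv, Equiv.coe_fn_mk]
  rw [ETerm_eq, ETerm_eq, rootTerm_T_smul _ hm, coe_T_smul]
  push_cast
  ring_nf

theorem mem_EIndex_add {p : ℤ × ℤ} (hp : p ∈ EIndex) {t : ℤ} (ht : Even t)
    (hpos : 0 < p.1 + t * p.2) : (p.1 + t * p.2, p.2) ∈ EIndex :=
  ⟨hpos, hp.2.1.add_even (ht.mul_right _), by simpa using hp.2.2⟩

theorem mem_EIndex_neg {p : ℤ × ℤ} (hp : p ∈ EIndex) {t : ℤ} (ht : Even t)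
    (hpos : ¬ 0 < p.1 + t * p.2) : (-(p.1 + t * p.2), -p.2) ∈ EIndex := by
  have hodd : Odd (p.1 + t * p.2) := hp.2.1.add_even (ht.mul_right _)
  have h0 : p.1 + t * p.2 ≠ 0 := by rintro h; simp [h] at hodd
  exact ⟨show 1 ≤ -(p.1 + t * p.2) by omega, hodd.neg, by simpa using hp.2.2⟩

/-- The map `(m, n) ↦ ±(m + tn, n)` on index pairs, the sign making the first entry positive. -/
def shearMap {t : ℤ} (ht : Even t) (p : EIndex) : EIndex :=
  if h : 0 < p.1.1 + t * p.1.2 then ⟨(p.1.1 + t * p.1.2, p.1.2), mem_EIndex_add p.2 ht h⟩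
  else ⟨(-(p.1.1 + t * p.1.2), -p.1.2), mem_EIndex_neg p.2 ht h⟩

theorem shearMap_neg_shearMap {t : ℤ} (ht : Even t) (p : EIndex) :
    shearMap ht.neg (shearMap ht p) = p := by
  have hm : 1 ≤ p.1.1 := p.2.1
  by_cases h : 0 < p.1.1 + t * p.1.2
  · have h1 : shearMap ht p = ⟨(p.1.1 + t * p.1.2, p.1.2), mem_EIndex_add p.2 ht h⟩ := dif_pos h
    rw [h1, shearMap, dif_pos (by simp; omega)]
    ext <;> simp
  · have h1 : shearMap ht p = ⟨(-(p.1.1 + t * p.1.2), -p.1.2), mem_EIndex_neg p.2 ht h⟩ :=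
      dif_neg h
    rw [h1, shearMap, dif_neg (by simp; omega)]
    ext <;> simp

/-- `shearMap` as a permutation of the index set. -/
def shearEquiv {t : ℤ} (ht : Even t) : EIndex ≃ EIndex where
  toFun := shearMap ht
  invFun := shearMap ht.neg
  left_inv := shearMap_neg_shearMap ht
  right_inv p := by
    have h := shearMap_neg_shearMap ht.neg p
    simpa only [neg_neg] using h

theorem E_lowerFour_smul (k : ℤ) (s : ℂ) (τ : ℍ) :
    E k s (lowerFour • τ) = autWeight k s lowerFour τ * E k s τ := by
  have h4 : Even (4 : ℤ) := by decide
  rw [E, E, ← (shearEquiv h4).tsum_eq fun p : EIndex => ETerm k s τ p.1.1 p.1.2, ← tsum_mul_left]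
  refine tsum_congr fun ⟨⟨m, n⟩, hp⟩ => ?_
  have hm : 0 < m := hp.1
  have hodd : Odd m := hp.2.1
  have hodd' : Odd (m + 4 * n) := hodd.add_even ⟨2 * n, by ring⟩
  have hne : m + 4 * n ≠ 0 := by rintro h; simp [h] at hodd'
  have hU := four_mul_add_one_ne_zero τ
  have hn4 : ((‖4 * (τ : ℂ) + 1‖ : ℝ) : ℂ) ^ (2 * s) ≠ 0 := by
    rw [Ne, Complex.cpow_eq_zero_iff]
    simp [hU]
  have hnorm : ((‖(m : ℂ) * (lowerFour • τ : ℍ) + n‖ : ℝ) : ℂ) ^ (2 * s) =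
      ((‖((m + 4 * n : ℤ) : ℂ) * τ + n‖ : ℝ) : ℂ) ^ (2 * s) /
        ((‖4 * (τ : ℂ) + 1‖ : ℝ) : ℂ) ^ (2 * s) := by
    rw [← linear_lowerFour_mul, norm_mul, Complex.ofReal_mul,
      Complex.mul_cpow_ofReal_nonneg (norm_nonneg _) (norm_nonneg _), mul_div_cancel_right₀ _ hn4]
  rw [ETerm_eq, hnorm, rootTerm_lowerFour_smul τ hm hodd, autWeight_lowerFour]
  by_cases hpos : 0 < m + 4 * n
  · have h1 : shearEquiv h4 ⟨(m, n), hp⟩ = ⟨(m + 4 * n, n), mem_EIndex_add hp h4 hpos⟩ :=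
      dif_pos hpos
    rw [h1, ETerm_eq, if_neg hpos.not_gt, one_mul, mul_zpow]
    field_simp
  · have h1 : shearEquiv h4 ⟨(m, n), hp⟩ = ⟨(-(m + 4 * n), -n), mem_EIndex_neg hp h4 hpos⟩ :=
      dif_neg hpos
    have hneg : m + 4 * n < 0 := by omega
    have hnn : ‖((-(m + 4 * n) : ℤ) : ℂ) * τ + ((-n : ℤ) : ℂ)‖ =
        ‖((m + 4 * n : ℤ) : ℂ) * τ + n‖ := by
      rw [← norm_neg]; congr 1; push_cast; ring
    -- `m > 0` and `m + 4n < 0` force `n < 0`, as the sign rule requires; its `-1` cancels the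
    -- branch sign.
    rw [h1, ETerm_eq, hnn, rootTerm_neg_neg τ hneg hodd' (by omega), if_pos hneg,
      show -1 * (4 * (τ : ℂ) + 1) ^ (1 / 2 : ℂ) * rootTerm τ (m + 4 * n) n =
        (4 * (τ : ℂ) + 1) ^ (1 / 2 : ℂ) * -rootTerm τ (m + 4 * n) n by ring, mul_zpow]
    field_simp

/-! ### The transformation law of `F` -/

theorem coe_fricke (τ : ℍ) : (fricke τ : ℂ) = -1 / (4 * τ) := rfl

/-- With `W` the Fricke involution, this is `UWT = W`, stated without inverses. -/
theorem fricke_T_smul (τ : ℍ) : lowerFour • fricke (ModularGroup.T • τ) = fricke τ := by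
  ext1
  have h0 := τ.ne_zero
  have h1 : (τ : ℂ) + 1 ≠ 0 := by simpa using linear_ne_zero (c := 1) (d := 1) (by simp) τ
  have h2 : 4 * (-1 / (4 * ((τ : ℂ) + 1))) + 1 = τ / (τ + 1) := by field_simp; ring
  rw [coe_lowerFour_smul, coe_fricke, coe_fricke, coe_T_smul, h2]
  field_simp

theorem fricke_lowerFour_smul (τ : ℍ) :
    ModularGroup.T • fricke (lowerFour • τ) = fricke τ := by
  ext1
  have h0 := τ.ne_zero
  have h1 := four_mul_add_one_ne_zero τ
  rw [coe_T_smul, coe_fricke, coe_fricke, coe_lowerFour_smul]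
  field_simp
  ring

theorem F_eq (k : ℤ) (s : ℂ) (τ : ℍ) :
    F k s τ = E k s (fricke τ) / (((τ : ℂ) ^ (1 / 2 : ℂ)) ^ (2 * k + 1) *
      ((‖(τ : ℂ)‖ : ℝ) : ℂ) ^ (2 * s)) := by
  rw [F, show -(k : ℂ) - 1 / 2 = -((k : ℂ) + 1 / 2) by ring, Complex.cpow_neg, cpow_add_half,
    neg_mul, Complex.cpow_neg]
  rw [← mul_inv, mul_comm, ← div_eq_mul_inv]

/-- If `w` and `zw` lie in the upper half-plane, the factor `z ↦ z^{k+1/2} |z|^{2s}` is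
multiplicative at `z, w`. -/
theorem weight_mul (k : ℤ) (s : ℂ) {z w : ℂ} (hz : z ≠ 0) (hw : 0 < w.im) (hzw : 0 < (z * w).im) :
    (((z * w) ^ (1 / 2 : ℂ)) ^ (2 * k + 1) * ((‖z * w‖ : ℝ) : ℂ) ^ (2 * s)) =
      ((z ^ (1 / 2 : ℂ)) ^ (2 * k + 1) * ((‖z‖ : ℝ) : ℂ) ^ (2 * s)) *
        ((w ^ (1 / 2 : ℂ)) ^ (2 * k + 1) * ((‖w‖ : ℝ) : ℂ) ^ (2 * s)) := by
  have h := cpow_half_mul hz hw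
  rw [if_neg (by rintro ⟨_, h⟩; exact absurd h (not_lt.2 hzw.le)), one_mul] at h
  rw [← h, mul_zpow, norm_mul, Complex.ofReal_mul,
    Complex.mul_cpow_ofReal_nonneg (norm_nonneg _) (norm_nonneg _)]
  ring

theorem weight_ne_zero (k : ℤ) (s : ℂ) {z : ℂ} (hz : z ≠ 0) :
    (z ^ (1 / 2 : ℂ)) ^ (2 * k + 1) * ((‖z‖ : ℝ) : ℂ) ^ (2 * s) ≠ 0 := by
  refine mul_ne_zero (zpow_ne_zero _ ?_) ?_ <;> rw [Ne, Complex.cpow_eq_zero_iff] <;> simp [hz]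

theorem F_T_smul (k : ℤ) (s : ℂ) (τ : ℍ) : F k s (ModularGroup.T • τ) = F k s τ := by
  have h1 : ((ModularGroup.T • τ : ℍ) : ℂ) ≠ 0 := (ModularGroup.T • τ).ne_zero
  have hw : (4 * (fricke (ModularGroup.T • τ) : ℂ) + 1) = τ / (ModularGroup.T • τ : ℍ) := by
    rw [coe_fricke]; field_simp; rw [coe_T_smul]; ring
  have hw0 : (τ : ℂ) / (ModularGroup.T • τ : ℍ) ≠ 0 := div_ne_zero τ.ne_zero h1
  -- The factor of `U` at `fricke (T • τ)` is `τ/(τ + 1)`; its weight times that of `τ + 1` is that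
  -- of `τ`, with no branch sign since `τ` and `τ + 1` lie in the upper half-plane.
  have hmul := weight_mul k s (z := (τ : ℂ) / (ModularGroup.T • τ : ℍ)) hw0
    (ModularGroup.T • τ).im_pos (by rw [div_mul_cancel₀ _ h1]; exact τ.im_pos)
  rw [div_mul_cancel₀ _ h1] at hmul
  rw [F_eq, F_eq, ← fricke_T_smul τ, E_lowerFour_smul, autWeight_lowerFour, hw, hmul,
    mul_div_mul_left _ _ (weight_ne_zero k s hw0)]

theorem F_lowerFour_smul (k : ℤ) (s : ℂ) (τ : ℍ) :
    F k s (lowerFour • τ) = autWeight k s lowerFour τ * F k s τ := by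
  have h4 := four_mul_add_one_ne_zero τ
  have hU : ((lowerFour • τ : ℍ) : ℂ) * (4 * τ + 1) = τ := by
    rw [coe_lowerFour_smul, div_mul_cancel₀ _ h4]
  have hmul := weight_mul k s (lowerFour • τ).ne_zero (im_four_mul_add_one_pos τ)
    (by rw [hU]; exact τ.im_pos)
  rw [hU] at hmul
  rw [F_eq, F_eq, ← fricke_lowerFour_smul τ, E_T_smul, autWeight_lowerFour, hmul,
    mul_div_assoc', mul_comm _ (E k s _), mul_div_mul_right _ _ (weight_ne_zero k s h4)]

theorem transformsOn_E (k : ℤ) (s : ℂ) : TransformsOn k s (E k s) :=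
  transformsOn_of_generators (E_T_smul k s) (E_lowerFour_smul k s)

theorem transformsOn_F (k : ℤ) (s : ℂ) : TransformsOn k s (F k s) :=
  transformsOn_of_generators (F_T_smul k s) (F_lowerFour_smul k s)

theorem transformsOn_H (k : ℤ) (s : ℂ) : TransformsOn k s (H k s) := by
  intro γ hγ τ
  rw [H, H, transformsOn_E k s γ hγ τ, transformsOn_F k s γ hγ τ]
  ring

end CohenEisenstein

end

theorem mainTheorem2 (k : ℤ) (s : ℂ) (hs : 3 / 4 - (k : ℝ) / 2 < s.re) :
    (∀ τ : UpperHalfPlane, Summable fun p : CohenEisenstein.EIndex =>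
      ‖CohenEisenstein.ETerm k s τ p.1.1 p.1.2‖) ∧
    CohenEisenstein.TransformsOn k s (CohenEisenstein.E k s) ∧
    CohenEisenstein.TransformsOn k s (CohenEisenstein.F k s) ∧
    (k ≠ 0 → CohenEisenstein.TransformsOn k s (CohenEisenstein.H k s)) :=
  ⟨CohenEisenstein.summable_norm_ETerm hs, CohenEisenstein.transformsOn_E k s,
    CohenEisenstein.transformsOn_F k s, fun _ => CohenEisenstein.transformsOn_H k s⟩
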